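/- **Definitions.** Let $2^{<\omega}$ be the set of finite binary strings, $|\sigma|$ the length of $\sigma$, and for an infinite binary sequence $X$ let $X\restriction_n$ be its first $n$ bits. A *supermartingale* is a function $h:2^{<\omega}\to\mathbb{R}^{\ge 0}$ with $h(\sigma 0)+h(\sigma 1)\le 2h(\sigma)$ for all $\sigma$. A function $f:2^{<\omega}\to\mathbb{R}^{\ge 0}$ is *left-c.e.* if there is a computable $f_0:2^{<\omega}\times\mathbb{N}\to\mathbb{Q}^{\ge 0}$, nondecreasing in its second argument, with $f(\sigma)=\lim_s f_0(\sigma,s)$ for each $\sigma$. A supermartingale is *c.e.* if it is left-c.e. For $g:\mathbb{N}\to\mathbb{N}$, a c.e. supermartingale $M$ is *$g$-granular* if there are a computable sequence of rationals $(q_i)$ whose series $\sum_i q_i$ converges and a left-c.e. function $P$ on $2^{<\omega}$ such that, for every $\sigma$, $P(\sigma)$ is an integer multiple of $2^{-g(|\sigma|)}$ and $M(\sigma)=P(\sigma)+\sum_{i\ge|\sigma|}q_i$. **Theorem (Granular supermartingales).** Let $g:\mathbb{N}\to\mathbb{N}$ be computable and nondecreasing. (a) If $\sum_i 2^{-g(i)}<\infty$,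 then for every c.e. supermartingale $N$ there is a $g$-granular c.e. supermartingale $M$ (for which moreover all the $q_i$ can be taken non-negative) such that for every infinite binary sequence $X$, $$\limsup_n M(X\restriction_n)=\infty\iff\limsup_n N(X\restriction_n)=\infty .$$ (b) If $\sum_i 2^{-g(i)}=\infty$, then there is a c.e. supermartingale $N$ such that for every $g$-granular c.e. supermartingale $M$ there is an infinite binary sequence $X$ with $$\limsup_n N(X\restriction_n)=\infty\quad\text{and}\quad\limsup_n M(X\restriction_n)<\infty .$$ -/

import Mathlib

/-- A rational-valued function on a coded type is computable: it is given by computable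
natural-number data (a difference of naturals over a positive natural). -/
def ComputableRat {α : Type} [Primcodable α] (f : α → ℚ) : Prop :=
  ∃ a b d : α → ℕ, Computable a ∧ Computable b ∧ Computable d ∧
    ∀ x, f x = ((a x : ℚ) - (b x : ℚ)) / ((d x : ℚ) + 1)

/-- The string consisting of the first `n` bits of the infinite binary sequence `X`. -/
def restr (X : ℕ → Bool) (n : ℕ) : List Bool := (List.range n).map X

/-- A supermartingale: a non-negative function on binary strings such that
`h(σ0) + h(σ1) ≤ 2 h(σ)`. -/
def IsSupermartingale (h : List Bool → ℝ) : Prop :=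
  (∀ σ, 0 ≤ h σ) ∧ ∀ σ, h (σ ++ [false]) + h (σ ++ [true]) ≤ 2 * h σ

/-- A left-c.e. function on binary strings: the pointwise limit of a computable sequence of
non-negative rational-valued functions that is nondecreasing in the stage `s`. -/
def IsLeftCE (f : List Bool → ℝ) : Prop :=
  ∃ f₀ : List Bool × ℕ → ℚ, ComputableRat f₀ ∧ (∀ p, 0 ≤ f₀ p) ∧
    (∀ σ, Monotone fun s => f₀ (σ, s)) ∧
    ∀ σ, Filter.Tendsto (fun s => (f₀ (σ, s) : ℝ)) Filter.atTop (nhds (f σ))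

/-- A c.e. supermartingale. -/
def IsCESupermartingale (h : List Bool → ℝ) : Prop :=
  IsSupermartingale h ∧ IsLeftCE h

/-- `M(σ)` is an integer multiple of `2^{-g(|σ|)}` for every string `σ`. -/
def IsGranularFunction (g : ℕ → ℕ) (M : List Bool → ℝ) : Prop :=
  ∀ σ, ∃ k : ℤ, M σ = (k : ℝ) * (2 : ℝ) ^ (-(g σ.length : ℤ))

/-- `M` is a c.e. supermartingale and the computable sequence of rationals `q` witnesses that it
is `g`-granular: `M(σ) = P(σ) + ∑_{i ≥ |σ|} q_i`, where the series converges to `f(|σ|)` and `P` is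
a left-c.e. function that is `g`-granular as a function. -/
def IsGranularCESupermartingaleVia (g : ℕ → ℕ) (q : ℕ → ℚ) (M : List Bool → ℝ) : Prop :=
  IsCESupermartingale M ∧ ComputableRat q ∧
    ∃ (P : List Bool → ℝ) (f : ℕ → ℝ), IsLeftCE P ∧ IsGranularFunction g P ∧
      (∀ n, Filter.Tendsto (fun k => ∑ i ∈ Finset.Ico n k, (q i : ℝ)) Filter.atTop (nhds (f n))) ∧
      ∀ σ, M σ = P σ + f σ.length

/-- A `g`-granular c.e. supermartingale. -/
def IsGranularCESupermartingale (g : ℕ → ℕ) (M : List Bool → ℝ) : Prop :=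
  ∃ q : ℕ → ℚ, IsGranularCESupermartingaleVia g q M

/-- `limsup_n h(X↾n)`, as an extended real. -/
noncomputable def limsupAlong (h : List Bool → ℝ) (X : ℕ → Bool) : EReal :=
  Filter.limsup (fun n => ((h (restr X n) : ℝ) : EReal)) Filter.atTop

/-! (a) Round `N` up to the grid of mesh `2^{-g(|σ|)}`. At length `n+1` each child gains at most
`2^{-g(n+1)}`, so the tail `f n = ∑_{i≥n} 2^{-g(i+1)}`, which drops by exactly that amount from `n`
to `n+1`, restores the supermartingale inequality. The sum `M` satisfies `N ≤ M ≤ N + 1 + f 0`, so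
both succeed on the same sequences.

(b) Let `N` bet the fraction `w i = 2^{-(g(i+1)+1)}` on `false` at each position. Against a granular
`M`, follow `false` unless `M` would rise. If it would, the two children differ by at least one grid
step `2 * w n` (`exists_sub_eq`), so `M` loses at least `w n` on `true`. Hence `M` stays below `M
[]` and the `true` bits have total weight at most `M []` (`greedyPath_add_le`). Since `∑ w`
diverges, the gains of `N` on `false` outweigh this bounded loss (`limsupAlong_fractionalBet`). -/

open Filter Finset

/-! ### Computability of rational-valued functions -/

section Computability

variable {α : Type} [Primcodable α]

theorem Computable.nat_two_pow {f : α → ℕ} (hf : Computable f) :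
    Computable fun x => 2 ^ f x := by
  have h : Primrec₂ (fun a b : ℕ => a ^ b) := Primrec₂.unpaired'.1 Nat.Primrec.pow
  exact h.to_comp.comp (Computable.const 2) hf

theorem Computable.nat_add' {f g : α → ℕ} (hf : Computable f) (hg : Computable g) :
    Computable fun x => f x + g x :=
  Primrec.nat_add.to_comp.comp hf hg

theorem Computable.nat_sub' {f g : α → ℕ} (hf : Computable f) (hg : Computable g) :
    Computable fun x => f x - g x :=
  Primrec.nat_sub.to_comp.comp hf hg

theorem Computable.nat_mul' {f g : α → ℕ} (hf : Computable f) (hg : Computable g) :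
    Computable fun x => f x * g x :=
  Primrec.nat_mul.to_comp.comp hf hg

theorem Computable.nat_div' {f g : α → ℕ} (hf : Computable f) (hg : Computable g) :
    Computable fun x => f x / g x :=
  Primrec.nat_div.to_comp.comp hf hg

theorem Computable.sum_range {n : α → ℕ} {f : α × ℕ → ℕ} (hn : Computable n)
    (hf : Computable f) : Computable fun x => ∑ i ∈ range (n x), f (x, i) := by
  have hstep : Computable₂ fun (x : α) (p : ℕ × ℕ) => p.2 + f (x, p.1) :=
    Computable.nat_add' (Computable.snd.comp Computable.snd)
      (hf.comp (Computable.pair Computable.fst (Computable.fst.comp Computable.snd)))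
  refine (Computable.nat_rec hn (Computable.const 0) hstep).of_eq fun x => ?_
  induction n x with
  | zero => simp
  | succ k ih => rw [sum_range_succ, ← ih]

theorem Computable.prod_range {n : α → ℕ} {f : α × ℕ → ℕ} (hn : Computable n)
    (hf : Computable f) : Computable fun x => ∏ i ∈ range (n x), f (x, i) := by
  have hstep : Computable₂ fun (x : α) (p : ℕ × ℕ) => p.2 * f (x, p.1) :=
    Computable.nat_mul' (Computable.snd.comp Computable.snd)
      (hf.comp (Computable.pair Computable.fst (Computable.fst.comp Computable.snd)))
  refine (Computable.nat_rec hn (Computable.const 1) hstep).of_eq fun x => ?_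
  induction n x with
  | zero => simp
  | succ k ih => rw [prod_range_succ, ← ih]

theorem ComputableRat.natCast_div {a d : α → ℕ} (ha : Computable a) (hd : Computable d)
    (hpos : ∀ x, 0 < d x) : ComputableRat fun x => (a x : ℚ) / (d x : ℚ) := by
  refine ⟨a, fun _ => 0, fun x => d x - 1, ha, Computable.const 0,
    hd.nat_sub' (Computable.const 1), fun x => ?_⟩
  have : ((d x - 1 : ℕ) : ℚ) + 1 = d x := by
    have := hpos x
    norm_cast
    omega
  rw [this]
  simp

theorem ComputableRat.add {f g : α → ℚ} (hf : ComputableRat f) (hg : ComputableRat g) :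
    ComputableRat fun x => f x + g x := by
  obtain ⟨a, b, d, ha, hb, hd, h⟩ := hf
  obtain ⟨a', b', d', ha', hb', hd', h'⟩ := hg
  refine ⟨fun x => a x * (d' x + 1) + a' x * (d x + 1),
    fun x => b x * (d' x + 1) + b' x * (d x + 1), fun x => d x * d' x + d x + d' x,
    ?_, ?_, ?_, fun x => ?_⟩
  · exact (ha.nat_mul' (hd'.nat_add' (Computable.const 1))).nat_add'
      (ha'.nat_mul' (hd.nat_add' (Computable.const 1)))
  · exact (hb.nat_mul' (hd'.nat_add' (Computable.const 1))).nat_add'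
      (hb'.nat_mul' (hd.nat_add' (Computable.const 1)))
  · exact ((hd.nat_mul' hd').nat_add' hd).nat_add' hd'
  · have h1 : (d x : ℚ) + 1 ≠ 0 := by positivity
    have h2 : (d' x : ℚ) + 1 ≠ 0 := by positivity
    have h3 : ((d x * d' x + d x + d' x : ℕ) : ℚ) + 1 = (d x + 1) * (d' x + 1) := by
      push_cast
      ring
    beta_reduce
    rw [h, h', h3]
    push_cast
    field_simp
    ring

/-- Rounding a non-negative computable rational up to a multiple of `2⁻ᵏ` is computable. -/
theorem ComputableRat.ceil_two_pow {f : α → ℚ} {k : α → ℕ} (hf : ComputableRat f)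
    (hnn : ∀ x, 0 ≤ f x) (hk : Computable k) :
    ComputableRat fun x => (⌈f x * 2 ^ k x⌉₊ : ℚ) / 2 ^ k x := by
  obtain ⟨a, b, d, ha, hb, hd, h⟩ := hf
  -- Natural division of `A + d` by `d + 1` rounds `A / (d + 1)` up. The truncated `a - b` is exact
  -- because `f ≥ 0`.
  have hceil : ∀ x, ⌈f x * 2 ^ k x⌉₊ = ((a x - b x) * 2 ^ k x + d x) / (d x + 1) := by
    intro x
    have hd0 : (0 : ℚ) < d x + 1 := by positivity
    have hab : b x ≤ a x := by
      have h0 := hnn x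
      rw [h, le_div_iff₀ hd0] at h0
      have : (b x : ℚ) ≤ a x := by linarith
      exact_mod_cast this
    have hfx : f x * 2 ^ k x = (((a x - b x) * 2 ^ k x : ℕ) : ℚ) / ((d x + 1 : ℕ) : ℚ) := by
      rw [h]
      push_cast [Nat.cast_sub hab]
      ring
    refine eq_of_forall_ge_iff fun c => ?_
    rw [Nat.ceil_le, hfx, div_le_iff₀ (by positivity), ← Nat.lt_succ_iff,
      Nat.div_lt_iff_lt_mul (by omega : 0 < d x + 1)]
    norm_cast
    rw [Nat.succ_eq_add_one, add_one_mul]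
    omega
  have h2 : Computable fun x => 2 ^ k x := hk.nat_two_pow
  have hnum : Computable fun x => ⌈f x * 2 ^ k x⌉₊ := by
    refine Computable.of_eq ?_ fun x => (hceil x).symm
    exact (((ha.nat_sub' hb).nat_mul' h2).nat_add' hd).nat_div'
      (hd.nat_add' (Computable.const 1))
  obtain ⟨a', b', d', ha', hb', hd', h'⟩ := ComputableRat.natCast_div hnum h2 fun x => by positivity
  exact ⟨a', b', d', ha', hb', hd', fun x => by rw [← h' x]; push_cast; rfl⟩

end Computability

/-! ### Limits superior along a sequence -/

theorem limsupAlong_eq_top_iff (h : List Bool → ℝ) (X : ℕ → Bool) :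
    limsupAlong h X = ⊤ ↔ ∀ y : ℝ, ∃ᶠ n in atTop, y < h (restr X n) := by
  rw [EReal.eq_top_iff_forall_lt]
  constructor
  · intro H y
    refine (frequently_lt_of_lt_limsup (h := H y)).mono fun n hn => ?_
    exact_mod_cast hn
  · intro H y
    refine lt_of_lt_of_le (b := ((y + 1 : ℝ) : EReal)) (by exact_mod_cast lt_add_one y) ?_
    refine le_limsup_of_frequently_le' ((H (y + 1)).mono fun n hn => ?_)
    exact_mod_cast hn.le

theorem limsupAlong_eq_top_of_le_add {h k : List Bool → ℝ} {C : ℝ} (hle : ∀ σ, h σ ≤ k σ + C)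
    {X : ℕ → Bool} (hX : limsupAlong h X = ⊤) : limsupAlong k X = ⊤ := by
  rw [limsupAlong_eq_top_iff] at hX ⊢
  intro y
  exact (hX (y + C)).mono fun n hn => by linarith [hle (restr X n)]

theorem limsupAlong_lt_top_of_le {h : List Bool → ℝ} {X : ℕ → Bool} {C : ℝ}
    (hle : ∀ n, h (restr X n) ≤ C) : limsupAlong h X < ⊤ :=
  lt_of_le_of_lt (limsup_le_of_le (by isBoundedDefault)
    (Eventually.of_forall fun n => EReal.coe_le_coe_iff.2 (hle n))) (EReal.coe_lt_top C)

theorem restr_succ (X : ℕ → Bool) (n : ℕ) : restr X (n + 1) = restr X n ++ [X n] := by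
  simp [restr, List.range_succ]

theorem restr_length (X : ℕ → Bool) (n : ℕ) : (restr X n).length = n := by
  simp [restr]

/-! ### Rounding a c.e. supermartingale -/

/-- `N` rounded up to the nearest multiple of `2^{-g(|σ|)}`. -/
noncomputable def granularCeil (g : ℕ → ℕ) (N : List Bool → ℝ) (σ : List Bool) : ℝ :=
  (⌈N σ * 2 ^ g σ.length⌉₊ : ℝ) / 2 ^ g σ.length

theorem le_granularCeil (g : ℕ → ℕ) (N : List Bool → ℝ) (σ : List Bool) :
    N σ ≤ granularCeil g N σ := by
  rw [granularCeil, le_div_iff₀ (by positivity)]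
  exact Nat.le_ceil _

theorem granularCeil_le (g : ℕ → ℕ) {N : List Bool → ℝ} {σ : List Bool} (h : 0 ≤ N σ) :
    granularCeil g N σ ≤ N σ + (2 ^ g σ.length)⁻¹ := by
  have hp : (0 : ℝ) < 2 ^ g σ.length := by positivity
  rw [granularCeil, div_le_iff₀ hp, add_mul, inv_mul_cancel₀ hp.ne']
  exact (Nat.ceil_lt_add_one (by positivity)).le

theorem isGranularFunction_granularCeil (g : ℕ → ℕ) (N : List Bool → ℝ) :
    IsGranularFunction g (granularCeil g N) := fun σ =>
  ⟨⌈N σ * 2 ^ g σ.length⌉₊, by simp [granularCeil, div_eq_mul_inv]⟩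

/-- The ceiling is left-continuous, so the ceilings of approximations from below are eventually
equal to the ceiling of the limit. -/
theorem isLeftCE_granularCeil {g : ℕ → ℕ} (hg : Computable g) {N : List Bool → ℝ}
    (hN : IsLeftCE N) : IsLeftCE (granularCeil g N) := by
  obtain ⟨f, hf, hnn, hmono, hlim⟩ := hN
  refine ⟨fun p => (⌈f p * 2 ^ g p.1.length⌉₊ : ℚ) / 2 ^ g p.1.length,
    hf.ceil_two_pow hnn (hg.comp (Computable.list_length.comp Computable.fst)),
    fun p => by positivity, fun σ s t hst => ?_, fun σ => ?_⟩
  · have := hmono σ hst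
    dsimp only at this ⊢
    gcongr
  · have hp : (0 : ℝ) < 2 ^ g σ.length := by positivity
    have hle : ∀ s, (f (σ, s) : ℝ) ≤ N σ := fun s =>
      Monotone.ge_of_tendsto (f := fun s => (f (σ, s) : ℝ))
        (fun s t hst => Rat.cast_le.2 (hmono σ hst)) (hlim σ) s
    have hev : ∀ᶠ s in atTop,
        ⌈(f (σ, s) : ℝ) * 2 ^ g σ.length⌉₊ = ⌈N σ * 2 ^ g σ.length⌉₊ := by
      -- The zero case is separate because the threshold `⌈·⌉₊ - 1` below needs a positive ceiling.
      rcases Nat.eq_zero_or_pos ⌈N σ * 2 ^ g σ.length⌉₊ with h0 | h0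
      · refine Eventually.of_forall fun s => ?_
        have : ⌈(f (σ, s) : ℝ) * 2 ^ g σ.length⌉₊ ≤ ⌈N σ * 2 ^ g σ.length⌉₊ :=
          Nat.ceil_mono (mul_le_mul_of_nonneg_right (hle s) hp.le)
        omega
      · have hlt : ((⌈N σ * 2 ^ g σ.length⌉₊ - 1 : ℕ) : ℝ) < N σ * 2 ^ g σ.length :=
          Nat.lt_ceil.1 (by omega)
        filter_upwards [((hlim σ).mul_const _).eventually (eventually_gt_nhds hlt)] with s hs
        have h1 := Nat.lt_ceil.2 hs
        have h2 : ⌈(f (σ, s) : ℝ) * 2 ^ g σ.length⌉₊ ≤ ⌈N σ * 2 ^ g σ.length⌉₊ :=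
          Nat.ceil_mono (mul_le_mul_of_nonneg_right (hle s) hp.le)
        omega
    refine (tendsto_congr' ?_).2 tendsto_const_nhds
    filter_upwards [hev] with s hs
    have hcast : ⌈(f (σ, s) : ℚ) * 2 ^ g σ.length⌉₊ = ⌈(f (σ, s) : ℝ) * 2 ^ g σ.length⌉₊ := by
      refine eq_of_forall_ge_iff fun c => ?_
      rw [Nat.ceil_le, Nat.ceil_le]
      exact_mod_cast Iff.rfl
    rw [hcast, hs, granularCeil]
    push_cast
    rfl

theorem IsLeftCE.add {f h : List Bool → ℝ} (hf : IsLeftCE f) (hh : IsLeftCE h) :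
    IsLeftCE fun σ => f σ + h σ := by
  obtain ⟨f₀, hc, hnn, hmono, hlim⟩ := hf
  obtain ⟨h₀, hc', hnn', hmono', hlim'⟩ := hh
  refine ⟨fun p => f₀ p + h₀ p, hc.add hc', fun p => add_nonneg (hnn p) (hnn' p),
    fun σ => (hmono σ).add (hmono' σ), fun σ => ?_⟩
  simpa using (hlim σ).add (hlim' σ)

/-- The partial sum up to stage `s` has common denominator `2 ^ g s`, as `g` is monotone. -/
theorem isLeftCE_tail {g : ℕ → ℕ} (hg : Computable g) (hmono : Monotone g) {f : ℕ → ℝ}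
    (hf : ∀ n, Tendsto (fun k => ∑ i ∈ Ico n k, (((2 ^ g (i + 1))⁻¹ : ℚ) : ℝ)) atTop
      (nhds (f n))) :
    IsLeftCE fun σ => f σ.length := by
  refine ⟨fun p => ∑ i ∈ Ico p.1.length p.2, (2 ^ g (i + 1))⁻¹, ?_,
    fun p => sum_nonneg fun i _ => by positivity, fun σ s t hst => ?_, fun σ => ?_⟩
  · have hfst : Computable fun p : List Bool × ℕ => p.1.length :=
      Computable.list_length.comp Computable.fst
    have hterm : Computable fun z : (List Bool × ℕ) × ℕ =>
        2 ^ (g z.1.2 - g (z.1.1.length + z.2 + 1)) :=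
      ((hg.comp (Computable.snd.comp Computable.fst)).nat_sub' (hg.comp
        (((hfst.comp Computable.fst).nat_add' Computable.snd).nat_add'
          (Computable.const 1)))).nat_two_pow
    have hnum := Computable.sum_range (Computable.snd.nat_sub' hfst) hterm
    obtain ⟨a, b, d, ha, hb, hd, h⟩ := ComputableRat.natCast_div hnum
      (hg.comp Computable.snd).nat_two_pow fun x => by positivity
    refine ⟨a, b, d, ha, hb, hd, fun p => ?_⟩
    rw [← h]
    beta_reduce
    rw [sum_Ico_eq_sum_range]
    push_cast
    rw [sum_div]
    refine sum_congr rfl fun i hi => ?_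
    have hi' := mem_range.1 hi
    have hle : g (p.1.length + i + 1) ≤ g p.2 := hmono (by omega)
    rw [inv_eq_one_div, div_eq_div_iff (by positivity) (by positivity), ← pow_add,
      Nat.sub_add_cancel hle, one_mul]
  · exact sum_le_sum_of_subset_of_nonneg (Ico_subset_Ico_right hst) fun i _ _ => by positivity
  · simpa only [Rat.cast_sum] using hf σ.length

theorem exists_granular_of_summable {g : ℕ → ℕ} (hg : Computable g) (hmono : Monotone g)
    (hsum : Summable fun i => (2 : ℝ) ^ (-(g i : ℤ))) {N : List Bool → ℝ}
    (hN : IsCESupermartingale N) :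
    ∃ (M : List Bool → ℝ) (q : ℕ → ℚ), (∀ i, 0 ≤ q i) ∧ IsGranularCESupermartingaleVia g q M ∧
      ∀ X : ℕ → Bool, limsupAlong M X = ⊤ ↔ limsupAlong N X = ⊤ := by
  obtain ⟨⟨hnn, hsup⟩, hce⟩ := hN
  -- The shift to `i + 1` makes the term dropped between lengths `n` and `n + 1` match the mesh of
  -- the children.
  set q : ℕ → ℚ := fun i => (2 ^ g (i + 1))⁻¹ with hq
  have hq0 : ∀ i, 0 ≤ q i := fun i => by positivity
  have hqR : ∀ i, (q i : ℝ) = (2 ^ g (i + 1))⁻¹ := fun i => by simp [hq]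
  have hqsum : Summable fun i => (q i : ℝ) := by
    have := (summable_nat_add_iff 1).2 hsum
    refine this.congr fun i => ?_
    simp [hqR]
  set f : ℕ → ℝ := fun n => (∑' i, (q i : ℝ)) - ∑ i ∈ range n, (q i : ℝ) with hf
  have hlim : ∀ n, Tendsto (fun k => ∑ i ∈ Ico n k, (q i : ℝ)) atTop (nhds (f n)) := by
    intro n
    refine (hqsum.hasSum.tendsto_sum_nat.sub_const _).congr' ?_
    filter_upwards [eventually_ge_atTop n] with k hk
    rw [sum_Ico_eq_sub _ hk]
  have hfstep : ∀ n, f n = f (n + 1) + (2 ^ g (n + 1))⁻¹ := by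
    intro n
    simp only [hf, sum_range_succ, hqR]
    ring
  have hf0 : ∀ n, 0 ≤ f n := fun n =>
    ge_of_tendsto' (hlim n) fun k => sum_nonneg fun i _ => by exact_mod_cast hq0 i
  have hfle : ∀ n, f n ≤ f 0 := by
    intro n
    have : 0 ≤ ∑ i ∈ range n, (q i : ℝ) := sum_nonneg fun i _ => by exact_mod_cast hq0 i
    simp only [hf, range_zero, sum_empty]
    linarith
  have hPce := isLeftCE_granularCeil hg hce
  refine ⟨fun σ => granularCeil g N σ + f σ.length, q, hq0, ⟨⟨⟨fun σ => ?_, fun σ => ?_⟩,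
    hPce.add (isLeftCE_tail hg hmono hlim)⟩, ?_, granularCeil g N, f, hPce,
    isGranularFunction_granularCeil g N, hlim, fun σ => rfl⟩, fun X => ⟨?_, ?_⟩⟩
  · exact add_nonneg ((hnn σ).trans (le_granularCeil g N σ)) (hf0 _)
  · have h0 := granularCeil_le g (hnn (σ ++ [false]))
    have h1 := granularCeil_le g (hnn (σ ++ [true]))
    simp only [List.length_append, List.length_singleton] at h0 h1 ⊢
    linarith [le_granularCeil g N σ, hsup σ, hfstep σ.length]
  · obtain ⟨a, b, d, ha, hb, hd, h⟩ := ComputableRat.natCast_div (Computable.const 1)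
      (hg.comp Computable.succ).nat_two_pow fun x => by positivity
    exact ⟨a, b, d, ha, hb, hd, fun i => by rw [← h]; simp [hq]⟩
  · refine limsupAlong_eq_top_of_le_add (C := 1 + f 0) fun σ => ?_
    have h1 : ((2 : ℝ) ^ g σ.length)⁻¹ ≤ 1 := inv_le_one_of_one_le₀ (one_le_pow₀ one_le_two)
    linarith [granularCeil_le g (hnn σ), hfle σ.length]
  · refine limsupAlong_eq_top_of_le_add (C := 0) fun σ => ?_
    linarith [le_granularCeil g N σ, hf0 σ.length]

/-! ### A martingale that no granular supermartingale covers -/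

/-- The computable martingale that, at each position `i`, bets the fraction `2^{-(g(i+1)+1)}` of
its capital on the bit `false`. -/
noncomputable def fractionalBet (g : ℕ → ℕ) (σ : List Bool) : ℝ :=
  ∏ i ∈ range σ.length,
    if σ[i]? = some true then 1 - ((2 : ℝ) ^ (g (i + 1) + 1))⁻¹
    else 1 + ((2 : ℝ) ^ (g (i + 1) + 1))⁻¹

theorem fractionalBet_append (g : ℕ → ℕ) (σ : List Bool) (b : Bool) :
    fractionalBet g (σ ++ [b]) = fractionalBet g σ *
      if b = true then 1 - ((2 : ℝ) ^ (g (σ.length + 1) + 1))⁻¹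
      else 1 + ((2 : ℝ) ^ (g (σ.length + 1) + 1))⁻¹ := by
  rw [fractionalBet, List.length_append, List.length_singleton, prod_range_succ, fractionalBet]
  congr 1
  · refine prod_congr rfl fun i hi => ?_
    rw [List.getElem?_append_left (mem_range.1 hi)]
  · simp

theorem inv_two_pow_succ_le_half (n : ℕ) : ((2 : ℝ) ^ (n + 1))⁻¹ ≤ 1 / 2 := by
  have : (1 : ℝ) ≤ 2 ^ n := one_le_pow₀ one_le_two
  rw [inv_le_comm₀ (by positivity) (by norm_num), pow_succ]
  linarith

theorem fractionalBet_nonneg (g : ℕ → ℕ) (σ : List Bool) : 0 ≤ fractionalBet g σ := by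
  refine prod_nonneg fun i _ => ?_
  have h := inv_two_pow_succ_le_half (g (i + 1))
  split_ifs
  · linarith
  · positivity

/-- The values are computable rationals, so an approximation constant in the stage suffices. -/
theorem isLeftCE_fractionalBet {g : ℕ → ℕ} (hg : Computable g) : IsLeftCE (fractionalBet g) := by
  set e : (List Bool × ℕ) × ℕ → ℕ := fun z => 2 ^ (g (z.2 + 1) + 1) with he
  set c : (List Bool × ℕ) × ℕ → ℕ := fun z =>
    bif decide (z.1.1[z.2]? = some true) then e z - 1 else e z + 1 with hc
  set f₀ : List Bool × ℕ → ℚ := fun p =>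
    ((∏ i ∈ range p.1.length, c (p, i) : ℕ) : ℚ) / ((∏ i ∈ range p.1.length, e (p, i) : ℕ) : ℚ)
    with hf₀
  have hecomp : Computable e :=
    ((hg.comp (Computable.succ.comp Computable.snd)).nat_add' (Computable.const 1)).nat_two_pow
  have hget : Computable fun z : (List Bool × ℕ) × ℕ => z.1.1[z.2]? :=
    Primrec.list_getElem?.to_comp.comp (Computable.fst.comp Computable.fst) Computable.snd
  have hbit : Computable fun z : (List Bool × ℕ) × ℕ => decide (z.1.1[z.2]? = some true) :=
    (Primrec.dom_finite fun o : Option Bool => decide (o = some true)).to_comp.comp hget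
  have hccomp : Computable c := Computable.cond hbit (hecomp.nat_sub' (Computable.const 1))
    (hecomp.nat_add' (Computable.const 1))
  have hlen : Computable fun p : List Bool × ℕ => p.1.length :=
    Computable.list_length.comp Computable.fst
  have hval : ∀ p, (f₀ p : ℝ) = fractionalBet g p.1 := by
    intro p
    simp only [hf₀, fractionalBet]
    push_cast
    rw [← prod_div_distrib]
    refine prod_congr rfl fun i _ => ?_
    have hpos : (0 : ℝ) < 2 ^ (g (i + 1) + 1) := by positivity
    by_cases h : p.1[i]? = some true
    · have h1 : 1 ≤ 2 ^ (g (i + 1) + 1) := Nat.one_le_two_pow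
      simp only [hc, he, h, decide_true, cond_true, if_true]
      push_cast [Nat.cast_sub h1]
      field_simp
    · simp only [hc, he, h, decide_false, cond_false, if_false]
      push_cast
      field_simp
  refine ⟨f₀, ComputableRat.natCast_div (Computable.prod_range hlen hccomp)
    (Computable.prod_range hlen hecomp) fun p => prod_pos fun i _ => by positivity,
    fun p => by positivity, fun σ s t _ => le_rfl, fun σ => ?_⟩
  simp only [hval]
  exact tendsto_const_nhds

theorem isCESupermartingale_fractionalBet {g : ℕ → ℕ} (hg : Computable g) :
    IsCESupermartingale (fractionalBet g) := by
  refine ⟨⟨fractionalBet_nonneg g, fun σ => ?_⟩, isLeftCE_fractionalBet hg⟩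
  rw [fractionalBet_append, fractionalBet_append]
  simp only [Bool.false_eq_true, if_false, if_true]
  linarith

/-- Reduces to `(1 + h)(1 - h/2) ≥ 1`. -/
theorem exp_le_one_add {h : ℝ} (h0 : 0 ≤ h) (h1 : h ≤ 1 / 2) : Real.exp (h / 2) ≤ 1 + h := by
  have hpos : 0 < 1 - h / 2 := by linarith
  have hexp : 1 - h / 2 ≤ Real.exp (-(h / 2)) := by linarith [Real.add_one_le_exp (-(h / 2))]
  have hmul : Real.exp (h / 2) * Real.exp (-(h / 2)) = 1 := by simp [← Real.exp_add]
  nlinarith [Real.exp_pos (h / 2)]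

/-- Reduces to `(1 - h)(1 + 2h) ≥ 1`. -/
theorem exp_le_one_sub {h : ℝ} (h0 : 0 ≤ h) (h1 : h ≤ 1 / 2) : Real.exp (-(2 * h)) ≤ 1 - h := by
  have hexp : 1 + 2 * h ≤ Real.exp (2 * h) := by linarith [Real.add_one_le_exp (2 * h)]
  have hmul : Real.exp (-(2 * h)) * Real.exp (2 * h) = 1 := by simp [← Real.exp_add]
  nlinarith [Real.exp_pos (-(2 * h))]

/-- `fractionalBet g` succeeds on every sequence whose `true` bits have bounded total weight. -/
theorem limsupAlong_fractionalBet {g : ℕ → ℕ}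
    (hdiv : ¬ Summable fun i => (2 : ℝ) ^ (-(g i : ℤ))) {X : ℕ → Bool} {C : ℝ}
    (hX : ∀ n, ∑ i ∈ range n, (if X i = true then ((2 : ℝ) ^ (g (i + 1) + 1))⁻¹ else 0) ≤ C) :
    limsupAlong (fractionalBet g) X = ⊤ := by
  set w : ℕ → ℝ := fun i => ((2 : ℝ) ^ (g (i + 1) + 1))⁻¹ with hw
  have hw0 : ∀ i, 0 ≤ w i := fun i => by positivity
  have hns : ¬ Summable w := by
    intro hs
    refine hdiv ((summable_nat_add_iff 1).1 ((hs.mul_left 2).congr fun i => ?_))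
    simp only [hw, zpow_neg, zpow_natCast, pow_succ]
    field_simp
  have hdivw := (not_summable_iff_tendsto_nat_atTop_of_nonneg hw0).1 hns
  -- A `false` bit contributes at least `w/2` to the exponent and a `true` bit at least `-2w`. As
  -- the first sum also counts the `true` bits, their correction is `5/2 = 1/2 + 2`.
  have hlow : ∀ n, Real.exp (1 / 2 * ∑ i ∈ range n, w i -
      5 / 2 * ∑ i ∈ range n, (if X i = true then w i else 0)) ≤ fractionalBet g (restr X n) := by
    intro n
    induction n with
    | zero => simp [fractionalBet, restr]
    | succ n ih =>
      rw [restr_succ, fractionalBet_append, restr_length, sum_range_succ, sum_range_succ]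
      have hn1 := inv_two_pow_succ_le_half (g (n + 1))
      cases hb : X n
      · have := mul_le_mul ih (exp_le_one_add (hw0 n) hn1) (Real.exp_pos _).le
          (fractionalBet_nonneg g _)
        rw [← Real.exp_add] at this
        simp only [Bool.false_eq_true, if_false]
        refine le_trans (le_of_eq ?_) this
        congr 1
        ring
      · have := mul_le_mul ih (exp_le_one_sub (hw0 n) hn1) (Real.exp_pos _).le
          (fractionalBet_nonneg g _)
        rw [← Real.exp_add] at this
        simp only [if_true]
        refine le_trans (le_of_eq ?_) this
        congr 1
        ring
  rw [limsupAlong_eq_top_iff]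
  intro y
  refine Eventually.frequently ?_
  filter_upwards [hdivw.eventually_ge_atTop (2 * (y + 5 / 2 * C))] with n hn
  refine lt_of_lt_of_le ?_ (hlow n)
  refine lt_of_lt_of_le ?_ (Real.add_one_le_exp _)
  linarith [hX n]

/-- The path that extends by `false` as long as `M` does not increase by doing so. -/
noncomputable def greedyPrefix (M : List Bool → ℝ) : ℕ → List Bool
  | 0 => []
  | n + 1 => greedyPrefix M n ++
      [decide (M (greedyPrefix M n) < M (greedyPrefix M n ++ [false]))]

/-- The infinite sequence with prefixes `greedyPrefix M n`. -/
noncomputable def greedyPath (M : List Bool → ℝ) (n : ℕ) : Bool :=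
  decide (M (greedyPrefix M n) < M (greedyPrefix M n ++ [false]))

theorem restr_greedyPath (M : List Bool → ℝ) (n : ℕ) :
    restr (greedyPath M) n = greedyPrefix M n := by
  induction n with
  | zero => simp [restr, greedyPrefix]
  | succ n ih => rw [restr_succ, ih, greedyPrefix, greedyPath]

/-- The tail of the series depends only on the length, so it cancels and only the granular part
remains. -/
theorem IsGranularCESupermartingale.exists_sub_eq {g : ℕ → ℕ} {M : List Bool → ℝ}
    (hM : IsGranularCESupermartingale g M) {σ τ : List Bool} (h : σ.length = τ.length) :
    ∃ k : ℤ, M σ - M τ = k * ((2 : ℝ) ^ g σ.length)⁻¹ := by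
  obtain ⟨q, -, -, P, f, -, hP, -, hMP⟩ := hM
  obtain ⟨k, hk⟩ := hP σ
  obtain ⟨l, hl⟩ := hP τ
  refine ⟨k - l, ?_⟩
  rw [hMP, hMP, hk, hl, h]
  push_cast
  rw [zpow_neg, zpow_natCast]
  ring

/-- Along the greedy path, the value of `M` together with the weight of the `true` bits never
exceeds the initial value of `M`. -/
theorem IsGranularCESupermartingale.greedyPath_add_le {g : ℕ → ℕ} {M : List Bool → ℝ}
    (hM : IsGranularCESupermartingale g M) (n : ℕ) :
    M (restr (greedyPath M) n) + ∑ i ∈ range n,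
      (if greedyPath M i = true then ((2 : ℝ) ^ (g (i + 1) + 1))⁻¹ else 0) ≤ M [] := by
  induction n with
  | zero => simp [restr]
  | succ n ih =>
    rw [restr_succ, sum_range_succ]
    set σ := restr (greedyPath M) n with hσ
    have hlen : σ.length = n := restr_length _ _
    have hbit : greedyPath M n = decide (M σ < M (σ ++ [false])) := by
      rw [hσ, restr_greedyPath, greedyPath]
    have hsup : M (σ ++ [false]) + M (σ ++ [true]) ≤ 2 * M σ := by
      obtain ⟨q, ⟨⟨-, h⟩, -⟩, -⟩ := hM
      exact h σ
    by_cases hlt : M σ < M (σ ++ [false])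
    · obtain ⟨k, hk⟩ := hM.exists_sub_eq (σ := σ ++ [false]) (τ := σ ++ [true]) (by simp)
      simp only [List.length_append, List.length_singleton, hlen] at hk
      have hpos : (0 : ℝ) < (2 ^ g (n + 1))⁻¹ := by positivity
      -- As `false` raises `M`, `true` lowers it, so the difference is positive; an integer multiple
      -- of the mesh is then at least one step.
      have hk1 : (1 : ℝ) ≤ k := by
        have : (0 : ℝ) < k := by
          by_contra! hk0
          nlinarith
        have : 0 < k := by exact_mod_cast this
        exact_mod_cast this
      have hhalf : ((2 : ℝ) ^ (g (n + 1) + 1))⁻¹ = (2 ^ g (n + 1))⁻¹ / 2 := by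
        rw [pow_succ, mul_inv, div_eq_mul_inv]
      rw [hbit, decide_eq_true hlt, if_pos rfl, hhalf]
      nlinarith
    · rw [hbit, decide_eq_false hlt]
      simp only [Bool.false_eq_true, if_false]
      linarith

theorem exists_uncovered_of_not_summable {g : ℕ → ℕ} (hg : Computable g)
    (hdiv : ¬ Summable fun i => (2 : ℝ) ^ (-(g i : ℤ))) :
    ∃ N : List Bool → ℝ, IsCESupermartingale N ∧
      ∀ M : List Bool → ℝ, IsGranularCESupermartingale g M →
        ∃ X : ℕ → Bool, limsupAlong N X = ⊤ ∧ limsupAlong M X < ⊤ := by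
  refine ⟨fractionalBet g, isCESupermartingale_fractionalBet hg, fun M hM =>
    ⟨greedyPath M, limsupAlong_fractionalBet hdiv (C := M []) fun n => ?_,
      limsupAlong_lt_top_of_le (C := M []) fun n => ?_⟩⟩
  · have hnn : 0 ≤ M (restr (greedyPath M) n) := by
      obtain ⟨q, ⟨⟨h, -⟩, -⟩, -⟩ := hM
      exact h _
    linarith [hM.greedyPath_add_le n]
  · have hnn : 0 ≤ ∑ i ∈ range n,
        (if greedyPath M i = true then ((2 : ℝ) ^ (g (i + 1) + 1))⁻¹ else 0) :=
      sum_nonneg fun i _ => by split_ifs <;> positivity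
    linarith [hM.greedyPath_add_le n]

theorem theorem4 (g : ℕ → ℕ) (hg_comp : Computable g) (hg_mono : Monotone g) :
    (Summable (fun i => (2 : ℝ) ^ (-(g i : ℤ))) →
      ∀ N : List Bool → ℝ, IsCESupermartingale N →
        ∃ (M : List Bool → ℝ) (q : ℕ → ℚ),
          (∀ i, 0 ≤ q i) ∧ IsGranularCESupermartingaleVia g q M ∧
          ∀ X : ℕ → Bool, limsupAlong M X = ⊤ ↔ limsupAlong N X = ⊤) ∧
    (¬ Summable (fun i => (2 : ℝ) ^ (-(g i : ℤ))) →
      ∃ N : List Bool → ℝ, IsCESupermartingale N ∧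
        ∀ M : List Bool → ℝ, IsGranularCESupermartingale g M →
          ∃ X : ℕ → Bool, limsupAlong N X = ⊤ ∧ limsupAlong M X < ⊤) :=
  ⟨fun hsum _ hN => exists_granular_of_summable hg_comp hg_mono hsum hN,
    fun hdiv => exists_uncovered_of_not_summable hg_comp hdiv⟩
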